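/- **Setting.** Let $n,N\ge 1$ and $d\ge 0$ be integers, and for $S\subseteq[n]$ and $x\in\{-1,1\}^n$ write $x_S=\prod_{i\in S}x_i$. Let - $\mathcal F_{\mathrm{LowDeg}}$ be the set of functions $f:\{-1,1\}^n\to[-1,1]$ of the form $f(x)=\sum_{S\subseteq[n],\,|S|\le d}\alpha_S x_S$ with $|\alpha_S|\le 1$ for all $S$; - $\mathcal F_{\mathrm{Cts}}$ be the set of continuous functions $f:[0,1]\to[-1,1]$ that are differentiable on $(0,1)$ with $f'\in[-1,1]$; - $\mathcal F_{\mathrm{Grid}}=\{f_1,\dots,f_N\}$, where $f_r(p)=1\{\frac{r-1}{N}\le p<\frac rN\}$ for $1\le r<N$ and $f_N(p)=1\{\frac{N-1}{N}\le p\le 1\}$. On $\{-1,1\}^n\times[0,1]$ consider the kernel $$k((x,p),(x',p'))=\left(\frac{(e^{m}+e^{-m})(e^{1-M}+e^{M-1})}{2(e-e^{-1})}+1\{\exists r\in[N]: f_r(p)=f_r(p')=1\}\right)\sum_{|S|\le d}x_Sx'_S,$$ where $m=\min\{p,p'\}$ and $M=\max\{p,p'\}$. **Protocol.** In each round $t=1,2,\dots$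 Nature chooses $x_t\in\{-1,1\}^n$ depending on the history $(x_i,p_i,y_i)_{i<t}$. The algorithm announces a distribution $\Delta_t$ on $[0,1]$. Nature chooses $y_t\in\{0,1\}$ depending on the history, $x_t$ and $\Delta_t$. Then $p_t\sim\Delta_t$ is drawn. **The Any Kernel algorithm.** Given the history and $x_t$, let $$S_t(p)=\sum_{i<t}k((x_t,p),(x_i,p_i))(y_i-p_i)+\tfrac12 k((x_t,p),(x_t,p))(1-2p).$$ For a candidate prediction $p$ let $B_t(p)$ be the maximum of $k((x_t,p),(x_t,p))$ and of $k((x_i,p_i),(x_i,p_i))$ over $i<t$, and let $\epsilon_t(p)=1/(10t^3B_t(p))$. 1. If $\operatorname{sign}S_t(0)=\operatorname{sign}S_t(1)\ne0$, then $\Delta_t$ is the point mass at $\frac12(1+\operatorname{sign}S_t(0))$. 2. Otherwise, if $k$ is continuous in the predictions, $\Delta_t$ is the point mass at some $p$ with $|S_t(p)|\le\epsilon_t(p)$. 3. Otherwise, $\Delta_t$ gives probability $\tau$ to $q$ and $1-\tau$ to $q'$, where $q,q'\in[0,1]$, $|q-q'|\le\min\{\epsilon_t(q),\epsilon_t(q')\}$,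 $S_t(q)$ has the sign of $S_t(0)$ or is zero, $S_t(q')$ has the sign of $S_t(1)$ or is zero, and $\tau=\frac{|S_t(q')|}{|S_t(q)|+|S_t(q')|}$ (with $\tau\in[0,1]$ arbitrary if the denominator is $0$). The points $p$, $q$, $q'$ may be any results of the numerical search that meet these conditions. **Claim.** After every history the algorithm has at least one admissible output $\Delta_t$. Moreover, for every way of choosing the admissible outputs (as a function of the history and $x_t$), every strategy of Nature, every $T\ge0$, every $f_x\in\mathcal F_{\mathrm{LowDeg}}$ and every $f_p\in\mathcal F_{\mathrm{Cts}}\cup\mathcal F_{\mathrm{Grid}}$, $$\left|\sum_{t=1}^T\mathbb E\big[f_x(x_t)\,f_p(p_t)\,(y_t-p_t)\big]\right|\le 6\sqrt{n^dT},$$ where the expectation is over the draws $p_t\sim\Delta_t$ of all rounds. -/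

import Mathlib

open scoped unitInterval

noncomputable section

namespace AnyKernel

/-! ### The online protocol -/

/-- One completed round: features `x`, realized prediction `p ∈ [0,1]`, outcome `y ∈ {0,1}`. -/
structure Round (X : Type*) where
  x : X
  p : I
  y : Bool

/-- The outcome as a real number, `0` or `1`. -/
def outcomeVal (y : Bool) : ℝ := if y then 1 else 0

/-- The history of the completed rounds, most recent round first. -/
abbrev History (X : Type*) := List (Round X)

/-- A distribution on `[0,1]` supported on at most two points: the point `q` with probability `τ`
and the point `q'` with probability `1 - τ`. -/
structure Forecast where
  q : I
  q' : I
  τ : I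

/-- The point mass at `p`. -/
def Forecast.pointMass (p : I) : Forecast := ⟨p, p, 1⟩

/-- The expectation of `g p` for `p` drawn from the forecast distribution. -/
def Forecast.expect (Δ : Forecast) (g : I → ℝ) : ℝ :=
  (Δ.τ : ℝ) * g Δ.q + (1 - (Δ.τ : ℝ)) * g Δ.q'

/-- An adaptive adversary. The features of a round may depend on the whole history (realized
predictions included), and the outcome on the history (hence on the current features) and on the
forecast distribution of the round, but not on the draw from it. -/
structure Nature (X : Type*) where
  features : History X → X
  outcome : History X → Forecast → Bool

/-- A forecasting rule: it maps the history and the current features to a distribution. -/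
abbrev Forecaster (X : Type*) := History X → X → Forecast

/-- The distribution `Δ_t` announced after history `h`. -/
def forecastAt {X : Type*} (A : Forecaster X) (ν : Nature X) (h : History X) : Forecast :=
  A h (ν.features h)

/-- The outcome `y_t` after history `h`. -/
def outcomeAt {X : Type*} (A : Forecaster X) (ν : Nature X) (h : History X) : Bool :=
  ν.outcome h (forecastAt A ν h)

/-- The expectation of `g h`, where `h` is the random history of the first `t` rounds played by `A`
against `ν` and in each round the prediction is drawn from the announced distribution. -/
def expectHistory {X : Type*} (A : Forecaster X) (ν : Nature X) : ℕ → (History X → ℝ) → ℝ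
  | 0, g => g []
  | t + 1, g => expectHistory A ν t fun h =>
      (forecastAt A ν h).expect fun p => g (⟨ν.features h, p, outcomeAt A ν h⟩ :: h)

/-- The expectation of `φ (x_t, p_t, y_t)` for the round that follows the first `t` rounds: the
prediction is drawn from the announced distribution, and the past is random as well. -/
def expectRound {X : Type*} (A : Forecaster X) (ν : Nature X) (t : ℕ)
    (φ : X → I → Bool → ℝ) : ℝ :=
  expectHistory A ν t fun h =>
    (forecastAt A ν h).expect fun p => φ (ν.features h) p (outcomeAt A ν h)

/-! ### The Any Kernel algorithm -/

/-- `S_t(p) = ∑_{i<t} k((x_t,p),(x_i,p_i)) (y_i - p_i) + (1/2) k((x_t,p),(x_t,p)) (1 - 2p)`. -/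
def score {X : Type*} (k : X × I → X × I → ℝ) (h : History X) (x : X) (p : I) : ℝ :=
  (h.map fun r => k (x, p) (r.x, r.p) * (outcomeVal r.y - (r.p : ℝ))).sum
    + 1 / 2 * k (x, p) (x, p) * (1 - 2 * (p : ℝ))

/-- `B_t = max_{t' ≤ t} k((x_{t'},p_{t'}),(x_{t'},p_{t'}))` when the current prediction is `p`. -/
def maxDiag {X : Type*} (k : X × I → X × I → ℝ) (h : History X) (x : X) (p : I) : ℝ :=
  (h.map fun r => k (r.x, r.p) (r.x, r.p)).foldr max (k (x, p) (x, p))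

/-- `ε_t = 1 / (10 t³ B_t)` when the current prediction is `p`; here `t = h.length + 1`. -/
def tolerance {X : Type*} (k : X × I → X × I → ℝ) (h : History X) (x : X) (p : I) : ℝ :=
  1 / (10 * ((h.length : ℝ) + 1) ^ 3 * maxDiag k h x p)

/-- The kernel is continuous in the predictions. -/
def ForecastContinuous {X : Type*} (k : X × I → X × I → ℝ) : Prop :=
  ∀ x x' : X, Continuous fun q : I × I => k (x, q.1) (x', q.2)

/-- The score has the same nonzero sign at both ends of `[0,1]`. -/
def SameSign (S : I → ℝ) : Prop :=
  SignType.sign (S 0) = SignType.sign (S 1) ∧ SignType.sign (S 0) ≠ 0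

/-- `Δ` is a legal output of the Any Kernel algorithm on history `h` and features `x`. All possible
results of the numerical searches are allowed.
* If `S 0` and `S 1` have the same nonzero sign, the output is the point `(1 + sign (S 0)) / 2`.
* Otherwise, if the kernel is continuous in `p`, the output is a point `p` with `|S p| ≤ ε_t`.
* Otherwise the output mixes two points at distance at most `ε_t` (whichever of the two is drawn),
  at which `S` has the sign of `S 0` and of `S 1` respectively (the search may also stop at a zero
  of `S`), with `τ = |S q'| / (|S q| + |S q'|)` (`τ` is arbitrary if both are zeros of `S`). -/
def IsOutput {X : Type*} (k : X × I → X × I → ℝ) (h : History X) (x : X) (Δ : Forecast) : Prop :=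
  (SameSign (score k h x) →
    (0 < score k h x 0 → Δ = Forecast.pointMass 1) ∧
    (score k h x 0 < 0 → Δ = Forecast.pointMass 0)) ∧
  (¬ SameSign (score k h x) → ForecastContinuous k →
    ∃ p : I, Δ = Forecast.pointMass p ∧ |score k h x p| ≤ tolerance k h x p) ∧
  (¬ SameSign (score k h x) → ¬ ForecastContinuous k →
    |(Δ.q' : ℝ) - Δ.q| ≤ min (tolerance k h x Δ.q) (tolerance k h x Δ.q') ∧
    (SignType.sign (score k h x Δ.q) = SignType.sign (score k h x 0) ∨ score k h x Δ.q = 0) ∧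
    (SignType.sign (score k h x Δ.q') = SignType.sign (score k h x 1) ∨ score k h x Δ.q' = 0) ∧
    (Δ.τ : ℝ) * (|score k h x Δ.q| + |score k h x Δ.q'|) = |score k h x Δ.q'|)

/-- `A` is an implementation of the Any Kernel algorithm with kernel `k`. -/
def IsAnyKernelAlgorithm {X : Type*} (k : X × I → X × I → ℝ) (A : Forecaster X) : Prop :=
  ∀ (h : History X) (x : X), IsOutput k h x (A h x)

/-! ### The kernel and the test functions -/

/-- The hypercube `{-1,1}^n`. -/
abbrev Cube (n : ℕ) := Fin n → ℤˣ

/-- `x_S = ∏_{i ∈ S} x_i`. -/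
def chi {n : ℕ} (S : Finset (Fin n)) (x : Cube n) : ℝ := ∏ i ∈ S, ((x i : ℤ) : ℝ)

/-- The sets `S ⊆ [n]` with `|S| ≤ d`. -/
def lowSets (n d : ℕ) : Finset (Finset (Fin n)) := Finset.univ.filter fun S => S.card ≤ d

/-- Functions `{-1,1}^n → [-1,1]` whose Fourier expansion has degree at most `d` and coefficients
bounded by `1`. -/
def lowDeg (n d : ℕ) : Set (Cube n → ℝ) :=
  {f | (∀ x, f x ∈ Set.Icc (-1 : ℝ) 1) ∧
    ∃ α : Finset (Fin n) → ℝ, (∀ S, |α S| ≤ 1) ∧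
      ∀ x, f x = ∑ S ∈ lowSets n d, α S * chi S x}

/-- Continuous functions `[0,1] → [-1,1]` that are differentiable with derivative in `[-1,1]`
(differentiability is only asked for in the open interval). -/
def ctsFun : Set (I → ℝ) :=
  {f | (∀ p, f p ∈ Set.Icc (-1 : ℝ) 1) ∧ Continuous f ∧
    ∀ p ∈ Set.Ioo (0 : ℝ) 1,
      DifferentiableAt ℝ (Set.IccExtend zero_le_one f) p ∧
      deriv (Set.IccExtend zero_le_one f) p ∈ Set.Icc (-1 : ℝ) 1}

/-- The `r`-th cell of the grid, `1 ≤ r ≤ N`: `[(r-1)/N, r/N)` for `r < N`, and `[(N-1)/N, 1]` for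
`r = N`. -/
def gridCell (N r : ℕ) : Set I :=
  {p | ((r : ℝ) - 1) / N ≤ p ∧ (r < N → (p : ℝ) < r / N)}

/-- The indicator `f_r` of the `r`-th cell. -/
def gridIndicator (N r : ℕ) : I → ℝ := (gridCell N r).indicator 1

/-- The set of the grid indicators `f_1, …, f_N`. -/
def gridFun (N : ℕ) : Set (I → ℝ) := {f | ∃ r ∈ Finset.Icc 1 N, f = gridIndicator N r}

/-- The reproducing kernel of the Sobolev space `W^{1,2}([0,1])`. -/
def sobolevKernel (p p' : I) : ℝ :=
  (Real.exp (min p p' : ℝ) + Real.exp (-(min p p' : ℝ))) *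
    (Real.exp (1 - (max p p' : ℝ)) + Real.exp ((max p p' : ℝ) - 1)) /
    (2 * (Real.exp 1 - Real.exp (-1)))

open Classical in
/-- `1` if `p` and `p'` lie in the same grid cell, else `0`. -/
def gridKernel (N : ℕ) (p p' : I) : ℝ :=
  if ∃ r ∈ Finset.Icc 1 N, gridIndicator N r p = 1 ∧ gridIndicator N r p' = 1 then 1 else 0

/-- The low-degree (ANOVA) kernel `∑_{|S| ≤ d} x_S x'_S`. -/
def lowDegKernel (n d : ℕ) (x x' : Cube n) : ℝ := ∑ S ∈ lowSets n d, chi S x * chi S x'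

/-- The kernel `(sobolevKernel + gridKernel) * lowDegKernel` on `{-1,1}^n × [0,1]`. -/
def productKernel (n d N : ℕ) (z z' : Cube n × I) : ℝ :=
  (sobolevKernel z.2 z'.2 + gridKernel N z.2 z'.2) * lowDegKernel n d z.1 z'.1

end AnyKernel

end

open scoped unitInterval

noncomputable section

namespace AnyKernel

/-! The kernel is a Gram kernel, `k z z' = ⟪Φ z, Φ z'⟫`, and each test function `f_x f_p` is `⟪w, Φ
·⟫` with `‖w‖² ≤ 2`. With `R = ∑ (y_t - p_t) Φ(x_t, p_t)`, the sum to be bounded is `E ⟪w, R⟫`, so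
Jensen and Cauchy–Schwarz bound its square by `‖w‖² E ‖R‖²` (`sq_sum_expectRound_le`).

Since `y ∈ {0,1}`, `(y - p)² = p(1 - p) + (y - p)(1 - 2p)`. Hence one round raises `‖R‖²` by exactly
`2(y - p) S_t(p) + k p(1 - p)`; this is the reason for the extra half-diagonal term in the score.
The algorithm keeps `E (y - p) S_t(p) ≤ 1/10` for both outcomes (`DiagDominated.expect_score_le`),
so `E ‖R‖²` grows by at most `C/4 + 1/5` per round when `k z z ≤ C`.

For the product kernel, `Φ(x, p)` consists of the blocks `x_S · (sobolevFeature p, gridFeature p)`,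
`|S| ≤ d`. The Sobolev block represents a smooth `f_p` by the pair `(f, f')` (`integral_sobolev`),
the grid block represents indicators by basis vectors, and Parseval controls the coefficients of
`f_x`. Finally `C = 3 · #{|S| ≤ d} ≤ 3(n^d + 1)`. -/

section Kernels

/-! ### The Sobolev kernel -/

open MeasureTheory Set

/-- The section `sobolevKernel p`, in terms of hyperbolic functions. -/
def sobolevSection (p x : ℝ) : ℝ :=
  Real.cosh (min p x) * Real.cosh (1 - max p x) / Real.sinh 1

/-- The derivative of `sobolevSection p` off the point `p`. -/
def sobolevSlope (p x : ℝ) : ℝ :=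
  if x ≤ p then Real.sinh x * Real.cosh (1 - p) / Real.sinh 1
  else -(Real.cosh p * Real.sinh (1 - x) / Real.sinh 1)

theorem sinh_one_pos : 0 < Real.sinh 1 := Real.sinh_pos_iff.2 one_pos

theorem sobolevKernel_eq (p p' : I) : sobolevKernel p p' = sobolevSection p p' := by
  have h := sinh_one_pos
  have h2 : Real.exp 1 - Real.exp (-1) = 2 * Real.sinh 1 := by rw [Real.sinh_eq]; ring
  unfold sobolevKernel sobolevSection
  rw [h2, Real.cosh_eq, Real.cosh_eq, neg_sub, div_eq_div_iff (by positivity) (by positivity)]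
  ring

theorem continuous_sobolevSection (p : ℝ) : Continuous (sobolevSection p) := by
  unfold sobolevSection
  fun_prop

theorem measurable_sobolevSlope (p : ℝ) : Measurable (sobolevSlope p) := by
  unfold sobolevSlope
  exact Measurable.ite measurableSet_Iic (by fun_prop) (by fun_prop)

theorem hasDerivAt_sobolevSection {p x : ℝ} (hx : x ≠ p) :
    HasDerivAt (sobolevSection p) (sobolevSlope p x) x := by
  rcases lt_or_gt_of_ne hx with hx | hx
  · have h1 : HasDerivAt (fun x => Real.cosh x * Real.cosh (1 - p) / Real.sinh 1)
        (sobolevSlope p x) x := by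
      rw [sobolevSlope, if_pos hx.le]
      exact ((Real.hasDerivAt_cosh x).mul_const _).div_const _
    refine h1.congr_of_eventuallyEq ?_
    filter_upwards [eventually_lt_nhds hx] with y hy
    simp [sobolevSection, hy.le]
  · have h1 : HasDerivAt (fun x => Real.cosh p * Real.cosh (1 - x) / Real.sinh 1)
        (sobolevSlope p x) x := by
      rw [sobolevSlope, if_neg hx.not_ge]
      have := ((((hasDerivAt_id x).const_sub 1).cosh).const_mul (Real.cosh p)).div_const
        (Real.sinh 1)
      refine this.congr_deriv ?_
      simp only [id]
      ring
    refine h1.congr_of_eventuallyEq ?_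
    filter_upwards [eventually_gt_nhds hx] with y hy
    simp [sobolevSection, hy.le]

/-- Lebesgue measure on the unit interval. -/
abbrev unitMeasure : Measure ℝ := volume.restrict (Ioc 0 1)

theorem memLp_unit {f : ℝ → ℝ} (hf : AEStronglyMeasurable f unitMeasure) {C : ℝ}
    (hC : ∀ x ∈ Ioc (0 : ℝ) 1, |f x| ≤ C) : MemLp f 2 unitMeasure :=
  MemLp.of_bound hf C ((ae_restrict_iff' measurableSet_Ioc).2 (.of_forall hC))

theorem memLp_unit_of_continuous {f : ℝ → ℝ} (hf : Continuous f) : MemLp f 2 unitMeasure := by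
  obtain ⟨C, hC⟩ := (isCompact_Icc (a := (0 : ℝ)) (b := 1)).exists_bound_of_continuousOn
    hf.continuousOn
  exact memLp_unit hf.aestronglyMeasurable fun x hx => hC x (Ioc_subset_Icc_self hx)

theorem memLp_sobolevSection (p : ℝ) : MemLp (sobolevSection p) 2 unitMeasure :=
  memLp_unit_of_continuous (continuous_sobolevSection p)

theorem memLp_sobolevSlope (p : ℝ) : MemLp (sobolevSlope p) 2 unitMeasure := by
  have h1 : MemLp (fun x => Real.sinh x * Real.cosh (1 - p) / Real.sinh 1) 2 unitMeasure :=
    memLp_unit_of_continuous (by fun_prop)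
  have h2 : MemLp (fun x => -(Real.cosh p * Real.sinh (1 - x) / Real.sinh 1)) 2 unitMeasure :=
    memLp_unit_of_continuous (by fun_prop)
  refine (h1.norm.add h2.norm).of_le (measurable_sobolevSlope p).aestronglyMeasurable
    (.of_forall fun x => ?_)
  simp only [sobolevSlope, Pi.add_apply]
  rw [Real.norm_of_nonneg (add_nonneg (norm_nonneg _) (norm_nonneg _))]
  split_ifs
  · exact le_add_of_nonneg_right (norm_nonneg _)
  · exact le_add_of_nonneg_left (norm_nonneg _)

/-- The reproducing property of the Sobolev kernel. -/
theorem integral_sobolev {F G : ℝ → ℝ} (hF : Continuous F) (hG : MemLp G 2 unitMeasure)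
    {s : Set ℝ} (hs : s.Countable) (hFG : ∀ x ∈ Ioo (0 : ℝ) 1 \ s, HasDerivAt F (G x) x) {p : ℝ}
    (hp : p ∈ Icc (0 : ℝ) 1) :
    (∫ x, F x * sobolevSection p x ∂unitMeasure) + ∫ x, G x * sobolevSlope p x ∂unitMeasure =
      F p := by
  have hsinh := sinh_one_pos
  have hi1 : Integrable (fun x => F x * sobolevSection p x) unitMeasure :=
    (memLp_unit_of_continuous hF).integrable_mul (memLp_sobolevSection p)
  have hi2 : Integrable (fun x => G x * sobolevSlope p x) unitMeasure :=
    hG.integrable_mul (memLp_sobolevSlope p)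
  set J : ℝ → ℝ := fun x => F x * sobolevSection p x + G x * sobolevSlope p x with hJ
  have hi : IntegrableOn J (Ioc 0 1) := hi1.add hi2
  rw [← integral_add hi1 hi2, ← intervalIntegral.integral_of_le zero_le_one]
  have hil : IntervalIntegrable J volume 0 p :=
    (intervalIntegrable_iff_integrableOn_Ioc_of_le hp.1).2
      (hi.mono_set (Ioc_subset_Ioc_right hp.2))
  have hir : IntervalIntegrable J volume p 1 :=
    (intervalIntegrable_iff_integrableOn_Ioc_of_le hp.2).2
      (hi.mono_set (Ioc_subset_Ioc_left hp.1))
  rw [← intervalIntegral.integral_add_adjacent_intervals hil hir]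
  -- On each side of `p` the section `K` satisfies `K'' = K`, so `F K'` is an antiderivative of `F K
  -- + F' K'`.
  have hl : ∫ x in (0 : ℝ)..p, J x =
      F p * (Real.sinh p * Real.cosh (1 - p) / Real.sinh 1) -
        F 0 * (Real.sinh 0 * Real.cosh (1 - p) / Real.sinh 1) := by
    refine integral_eq_of_hasDerivAt_off_countable_of_le
      (fun x => F x * (Real.sinh x * Real.cosh (1 - p) / Real.sinh 1)) J hp.1 hs
      (by fun_prop) (fun x hx => ?_) hil
    have h1 := (hFG x ⟨⟨hx.1.1, hx.1.2.trans_le hp.2⟩, hx.2⟩).mul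
      (((Real.hasDerivAt_sinh x).mul_const (Real.cosh (1 - p))).div_const (Real.sinh 1))
    refine h1.congr_deriv ?_
    have hxp := hx.1.2.le
    simp only [hJ, sobolevSection, sobolevSlope, hxp, if_true, min_eq_right, max_eq_left]
    ring
  have hr : ∫ x in p..1, J x =
      F 1 * -(Real.cosh p * Real.sinh (1 - 1) / Real.sinh 1) -
        F p * -(Real.cosh p * Real.sinh (1 - p) / Real.sinh 1) := by
    refine integral_eq_of_hasDerivAt_off_countable_of_le
      (fun x => F x * -(Real.cosh p * Real.sinh (1 - x) / Real.sinh 1)) J hp.2 hs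
      (by fun_prop) (fun x hx => ?_) hir
    have h1 := (hFG x ⟨⟨hp.1.trans_lt hx.1.1, hx.1.2⟩, hx.2⟩).mul
      (((((hasDerivAt_id x).const_sub 1).sinh).const_mul (Real.cosh p)).div_const
        (Real.sinh 1)).neg
    refine h1.congr_deriv ?_
    have hxp := hx.1.1.le
    simp only [hJ, sobolevSection, sobolevSlope, hx.1.1.not_ge, if_false, min_eq_left hxp,
      max_eq_right hxp, id, Pi.neg_apply]
    ring
  -- The slope vanishes at `0` and at `1`, so only the jump of `K'` at `p` survives; by the addition
  -- formula it has size one.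
  have hadd : Real.sinh 1 = Real.sinh p * Real.cosh (1 - p) + Real.cosh p * Real.sinh (1 - p) := by
    rw [← Real.sinh_add]
    congr 1
    ring
  rw [hl, hr, sub_self, Real.sinh_zero]
  field_simp
  rw [hadd]
  ring

/-- The Hilbert space that contains the Sobolev space `W^{1,2}([0,1])`: a function is represented
by itself and its derivative. -/
abbrev SobolevSpace : Type := WithLp 2 (Lp ℝ 2 unitMeasure × Lp ℝ 2 unitMeasure)

/-- The pair `(f, g)` as an element of `SobolevSpace`. -/
def toSobolev {f g : ℝ → ℝ} (hf : MemLp f 2 unitMeasure) (hg : MemLp g 2 unitMeasure) :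
    SobolevSpace :=
  WithLp.toLp 2 (hf.toLp f, hg.toLp g)

theorem inner_toLp {f g : ℝ → ℝ} (hf : MemLp f 2 unitMeasure) (hg : MemLp g 2 unitMeasure) :
    inner ℝ (hf.toLp f) (hg.toLp g) = ∫ x, f x * g x ∂unitMeasure := by
  rw [L2.inner_def]
  refine integral_congr_ae ?_
  filter_upwards [hf.coeFn_toLp, hg.coeFn_toLp] with x h1 h2
  rw [h1, h2]
  simp [mul_comm]

theorem inner_toSobolev {f g f' g' : ℝ → ℝ} (hf : MemLp f 2 unitMeasure)
    (hg : MemLp g 2 unitMeasure) (hf' : MemLp f' 2 unitMeasure) (hg' : MemLp g' 2 unitMeasure) :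
    inner ℝ (toSobolev hf hg) (toSobolev hf' hg') =
      (∫ x, f x * f' x ∂unitMeasure) + ∫ x, g x * g' x ∂unitMeasure := by
  rw [WithLp.prod_inner_apply, ← inner_toLp hf hf', ← inner_toLp hg hg']
  rfl

/-- The feature map of the Sobolev kernel. -/
def sobolevFeature (p : I) : SobolevSpace :=
  toSobolev (memLp_sobolevSection p) (memLp_sobolevSlope p)

/-- The reproducing property is applied to a section of the kernel itself, whose only possible point
of non-differentiability is `p`. -/
theorem inner_sobolevFeature (p p' : I) :
    inner ℝ (sobolevFeature p) (sobolevFeature p') = sobolevKernel p p' := by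
  rw [sobolevFeature, sobolevFeature, inner_toSobolev, sobolevKernel_eq]
  exact integral_sobolev (continuous_sobolevSection p) (memLp_sobolevSlope p)
    (countable_singleton (p : ℝ)) (fun x hx => hasDerivAt_sobolevSection hx.2) p'.2

/-- The representer is `(f, f')`; each component is bounded by `1` on an interval of length `1`,
whence the norm bound `1 + 1`. -/
theorem exists_inner_sobolevFeature {f : I → ℝ} (hf : f ∈ ctsFun) :
    ∃ w : SobolevSpace, ‖w‖ ^ 2 ≤ 2 ∧ ∀ p, inner ℝ w (sobolevFeature p) = f p := by
  obtain ⟨hbd, hcont, hdiff⟩ := hf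
  set F : ℝ → ℝ := IccExtend zero_le_one f with hFdef
  -- Cutting off outside the open interval makes the bound by `1` hold everywhere, with no
  -- discussion of the endpoints.
  set G : ℝ → ℝ := (Ioo (0 : ℝ) 1).indicator (deriv F) with hGdef
  have hF : Continuous F := hcont.Icc_extend'
  have hF1 : ∀ x, |F x| ≤ 1 := fun x => abs_le.2 (hbd _)
  have hG1 : ∀ x, |G x| ≤ 1 := fun x => by
    by_cases hx : x ∈ Ioo (0 : ℝ) 1
    · rw [hGdef, indicator_of_mem hx]
      exact abs_le.2 (hdiff x hx).2
    · rw [hGdef, indicator_of_notMem hx]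
      simp
  have hGm : Measurable G := (measurable_deriv F).indicator measurableSet_Ioo
  have mF : MemLp F 2 unitMeasure := memLp_unit_of_continuous hF
  have mG : MemLp G 2 unitMeasure := memLp_unit hGm.aestronglyMeasurable fun x _ => hG1 x
  have hle : ∀ {g : ℝ → ℝ}, (∀ x, |g x| ≤ 1) → MemLp g 2 unitMeasure →
      ∫ x, g x * g x ∂unitMeasure ≤ 1 := by
    intro g hg mg
    have h1 : ∫ x, g x * g x ∂unitMeasure ≤ ∫ _x, (1 : ℝ) ∂unitMeasure := by
      refine integral_mono (mg.integrable_mul mg) (integrable_const _) fun x => ?_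
      have := abs_le.1 (hg x)
      nlinarith
    simpa using h1
  refine ⟨toSobolev mF mG, ?_, fun p => ?_⟩
  · rw [← real_inner_self_eq_norm_sq, inner_toSobolev]
    linarith [hle hF1 mF, hle hG1 mG]
  · rw [sobolevFeature, inner_toSobolev,
      integral_sobolev hF mG countable_empty (fun x hx => ?_) p.2]
    · exact IccExtend_val _ f p
    · rw [hGdef, indicator_of_mem hx.1]
      exact (hdiff x hx.1).1.hasDerivAt

theorem sobolevKernel_nonneg (p p' : I) : 0 ≤ sobolevKernel p p' := by
  have := sinh_one_pos
  rw [sobolevKernel_eq, sobolevSection]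
  have := Real.cosh_pos (min (p : ℝ) p')
  have := Real.cosh_pos (1 - max (p : ℝ) p')
  positivity

/-- The addition formula for `cosh` reduces the bound to `coth 1 ≤ 2`, which follows from `cosh 1 -
sinh 1 = e⁻¹ ≤ 1 ≤ sinh 1`. -/
theorem sobolevKernel_self_le (p : I) : sobolevKernel p p ≤ 2 := by
  have hs := sinh_one_pos
  have h0 := p.2.1
  have h1 := p.2.2
  have hc : Real.cosh p * Real.cosh (1 - p) ≤ Real.cosh 1 := by
    have h2 : Real.cosh 1 = Real.cosh p * Real.cosh (1 - p) + Real.sinh p * Real.sinh (1 - p) := by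
      rw [← Real.cosh_add]
      congr 1
      ring
    have := mul_nonneg (Real.sinh_nonneg_iff.2 h0) (Real.sinh_nonneg_iff.2 (sub_nonneg.2 h1))
    linarith
  have hcs : Real.cosh 1 ≤ 2 * Real.sinh 1 := by
    have h3 := Real.cosh_sub_sinh 1
    have h4 : Real.exp (-1) ≤ 1 := Real.exp_le_one_iff.2 (by norm_num)
    have h5 : 1 ≤ Real.sinh 1 := Real.self_le_sinh_iff.2 zero_le_one
    linarith
  rw [sobolevKernel_eq, sobolevSection, min_self, max_self, div_le_iff₀ hs]
  linarith

/-! ### The grid kernel -/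

theorem gridIndicator_apply (N r : ℕ) (p : I) [Decidable (p ∈ gridCell N r)] :
    gridIndicator N r p = if p ∈ gridCell N r then 1 else 0 := by
  classical
  simp [gridIndicator, indicator_apply]

theorem gridIndicator_eq_one_iff (N r : ℕ) (p : I) :
    gridIndicator N r p = 1 ↔ p ∈ gridCell N r := by
  classical
  rw [gridIndicator_apply]
  split_ifs with h <;> simp [h]

theorem gridCell_unique {N r s : ℕ} (hr : r ∈ Finset.Icc 1 N) (hs : s ∈ Finset.Icc 1 N) {p : I}
    (hpr : p ∈ gridCell N r) (hps : p ∈ gridCell N s) : r = s := by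
  rw [Finset.mem_Icc] at hr hs
  have hN : (0 : ℝ) < N := by exact_mod_cast hr.1.trans hr.2
  have key : ∀ {r s : ℕ}, s ≤ N → p ∈ gridCell N r → p ∈ gridCell N s → ¬ r < s := by
    intro r s hs hpr hps hlt
    have h1 := (hpr.2 (hlt.trans_le hs)).trans_le' hps.1
    rw [div_lt_div_iff_of_pos_right hN] at h1
    have h2 : (r : ℝ) + 1 ≤ s := by exact_mod_cast hlt
    linarith
  have h1 := key hs.2 hpr hps
  have h2 := key hr.2 hps hpr
  omega

theorem exists_mem_gridCell {N : ℕ} (hN : 1 ≤ N) (p : I) :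
    ∃ r ∈ Finset.Icc 1 N, p ∈ gridCell N r := by
  have hN' : (0 : ℝ) < N := by exact_mod_cast hN
  have hp0 : 0 ≤ (p : ℝ) * N := mul_nonneg p.2.1 hN'.le
  by_cases h : ⌊(p : ℝ) * N⌋₊ < N
  · refine ⟨⌊(p : ℝ) * N⌋₊ + 1, Finset.mem_Icc.2 ⟨by omega, h⟩, ?_, fun _ => ?_⟩
    · push_cast
      rw [add_sub_cancel_right, div_le_iff₀ hN']
      exact Nat.floor_le hp0
    · push_cast
      rw [lt_div_iff₀ hN']
      exact Nat.lt_floor_add_one _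
  -- This is the case `p = 1`, which the closed last cell absorbs.
  · refine ⟨N, Finset.mem_Icc.2 ⟨hN, le_rfl⟩, ?_, fun h => absurd h (lt_irrefl _)⟩
    rw [div_le_iff₀ hN']
    have := (Nat.le_floor_iff hp0).1 (not_lt.1 h)
    linarith

/-- The feature map of the grid kernel. -/
def gridFeature (N : ℕ) (p : I) : EuclideanSpace ℝ (Finset.Icc 1 N) :=
  WithLp.toLp 2 fun r => gridIndicator N r p

/-- The cells are disjoint, so at most one term of `∑ f_r(p) f_r(p')` is nonzero and the sum equals
the indicator of a common cell. -/
theorem inner_gridFeature (N : ℕ) (p p' : I) :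
    inner ℝ (gridFeature N p) (gridFeature N p') = gridKernel N p p' := by
  classical
  have h1 : inner ℝ (gridFeature N p) (gridFeature N p') =
      ∑ r ∈ Finset.Icc 1 N, gridIndicator N r p * gridIndicator N r p' := by
    rw [← Finset.sum_coe_sort, PiLp.inner_apply]
    simp [gridFeature, mul_comm]
  rw [h1, gridKernel]
  simp only [gridIndicator_eq_one_iff]
  split_ifs with h
  · obtain ⟨r, hr, hp, hp'⟩ := h
    rw [Finset.sum_eq_single_of_mem r hr fun s hs hsr => ?_]
    · simp [gridIndicator_apply, hp, hp']
    · rw [gridIndicator_apply, if_neg fun hps => hsr (gridCell_unique hs hr hps hp), zero_mul]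
  · refine Finset.sum_eq_zero fun r hr => ?_
    push Not at h
    by_cases hp : p ∈ gridCell N r
    · rw [gridIndicator_apply N r p', if_neg (h r hr hp), mul_zero]
    · rw [gridIndicator_apply N r p, if_neg hp, zero_mul]

theorem gridKernel_self {N : ℕ} (hN : 1 ≤ N) (p : I) : gridKernel N p p = 1 := by
  obtain ⟨r, hr, hp⟩ := exists_mem_gridCell hN p
  rw [gridKernel, if_pos]
  rw [← gridIndicator_eq_one_iff] at hp
  exact ⟨r, hr, hp, hp⟩

theorem exists_inner_gridFeature {N : ℕ} {f : I → ℝ} (hf : f ∈ gridFun N) :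
    ∃ w : EuclideanSpace ℝ (Finset.Icc 1 N), ‖w‖ ^ 2 ≤ 2 ∧
      ∀ p, inner ℝ w (gridFeature N p) = f p := by
  classical
  obtain ⟨r, hr, rfl⟩ := hf
  refine ⟨EuclideanSpace.single ⟨r, hr⟩ 1, by simp, fun p => ?_⟩
  simp [EuclideanSpace.inner_single_left, gridFeature]

end Kernels

/-! ### Characters of the cube -/

section Characters

variable {n : ℕ}

theorem chi_sq (S : Finset (Fin n)) (x : Cube n) : chi S x * chi S x = 1 := by
  rw [chi, ← Finset.prod_mul_distrib]
  refine Finset.prod_eq_one fun i _ => ?_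
  rcases Int.units_eq_one_or (x i) with h | h <;> simp [h]

/-- Orthogonality of characters: the sum over the cube factors over coordinates, and a coordinate in
exactly one of `S`, `T` contributes the factor `1 + (-1) = 0`. -/
theorem sum_chi_mul_chi (S T : Finset (Fin n)) :
    ∑ x : Cube n, chi S x * chi T x = if S = T then (2 : ℝ) ^ n else 0 := by
  classical
  split_ifs with h
  · subst h
    simp [chi_sq]
  · obtain ⟨i, hi⟩ : ∃ i, ¬ (i ∈ S ↔ i ∈ T) := by
      by_contra hc
      push Not at hc
      exact h (Finset.ext hc)
    have hprod : ∀ x : Cube n, chi S x * chi T x =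
        ∏ j, (if j ∈ S then ((x j : ℤ) : ℝ) else 1) * (if j ∈ T then ((x j : ℤ) : ℝ) else 1) := by
      intro x
      rw [Finset.prod_mul_distrib, Finset.prod_ite_mem, Finset.prod_ite_mem]
      simp [chi]
    simp only [hprod]
    rw [← Fintype.prod_sum (fun j (u : ℤˣ) =>
      (if j ∈ S then ((u : ℤ) : ℝ) else 1) * (if j ∈ T then ((u : ℤ) : ℝ) else 1))]
    refine Finset.prod_eq_zero (Finset.mem_univ i) ?_
    have huniv : (Finset.univ : Finset ℤˣ) = {1, -1} := rfl
    rw [huniv, Finset.sum_pair (by decide)]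
    by_cases h1 : i ∈ S <;> by_cases h2 : i ∈ T <;> simp_all

/-- Parseval: the sum of the squared coefficients is the mean of `f²` over the cube. -/
theorem sum_sq_coeff_le_one {d : ℕ} {f : Cube n → ℝ} (hf : ∀ x, f x ∈ Set.Icc (-1 : ℝ) 1)
    {α : Finset (Fin n) → ℝ} (hα : ∀ x, f x = ∑ S ∈ lowSets n d, α S * chi S x) :
    ∑ S ∈ lowSets n d, α S ^ 2 ≤ 1 := by
  have h1 : ∑ x, f x ^ 2 = 2 ^ n * ∑ S ∈ lowSets n d, α S ^ 2 := by
    calc ∑ x, f x ^ 2 = ∑ x, ∑ S ∈ lowSets n d, ∑ T ∈ lowSets n d,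
          α S * α T * (chi S x * chi T x) := by
          refine Finset.sum_congr rfl fun x _ => ?_
          rw [hα, sq, Finset.sum_mul_sum]
          refine Finset.sum_congr rfl fun S _ => Finset.sum_congr rfl fun T _ => by ring
      _ = ∑ S ∈ lowSets n d, ∑ T ∈ lowSets n d, α S * α T * ∑ x, chi S x * chi T x := by
          rw [Finset.sum_comm]
          refine Finset.sum_congr rfl fun S _ => ?_
          rw [Finset.sum_comm]
          simp only [Finset.mul_sum]
      _ = _ := by
          rw [Finset.mul_sum]
          refine Finset.sum_congr rfl fun S hS => ?_
          simp only [sum_chi_mul_chi, mul_ite, mul_zero, Finset.sum_ite_eq, if_pos hS]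
          ring
  have h2 : ∑ x, f x ^ 2 ≤ 2 ^ n := by
    calc ∑ x, f x ^ 2 ≤ ∑ _x : Cube n, (1 : ℝ) := by
          refine Finset.sum_le_sum fun x _ => ?_
          obtain ⟨h3, h4⟩ := hf x
          nlinarith
      _ = 2 ^ n := by simp
  rw [h1] at h2
  exact (mul_le_iff_le_one_right (by positivity)).1 h2

/-! ### Counting the sets of size at most `d` -/

theorem lowDegKernel_self (d : ℕ) (x : Cube n) :
    lowDegKernel n d x x = (lowSets n d).card := by
  simp [lowDegKernel, chi_sq]

theorem one_le_card_lowSets (n d : ℕ) : 1 ≤ (lowSets n d).card :=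
  Finset.card_pos.2 ⟨∅, by simp [lowSets]⟩

theorem card_lowSets_succ (n d : ℕ) :
    (lowSets n (d + 1)).card = (lowSets n d).card + n.choose (d + 1) := by
  classical
  have h : lowSets n (d + 1) = lowSets n d ∪ Finset.powersetCard (d + 1) Finset.univ := by
    ext S
    simp only [lowSets, Finset.mem_filter, Finset.mem_univ, true_and, Finset.mem_union,
      Finset.mem_powersetCard, Finset.subset_univ]
    omega
  rw [h, Finset.card_union_of_disjoint, Finset.card_powersetCard, Finset.card_univ,
    Fintype.card_fin]
  rw [Finset.disjoint_left]
  intro S hS hS'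
  simp only [lowSets, Finset.mem_filter, Finset.mem_powersetCard] at hS hS'
  omega

/-- The right side is the increment `n ^ (d + 2) - n ^ (d + 1)`, so that the induction for
`card_lowSets_le` telescopes. -/
theorem choose_succ_succ_le (n d : ℕ) : n.choose (d + 2) ≤ (n - 1) * n ^ (d + 1) := by
  calc n.choose (d + 2) ≤ n.choose (d + 2) * (d + 2) := Nat.le_mul_of_pos_right _ (by omega)
    _ = n.choose (d + 1) * (n - (d + 1)) := Nat.choose_succ_right_eq n (d + 1)
    _ ≤ n ^ (d + 1) * (n - 1) := Nat.mul_le_mul (Nat.choose_le_pow n (d + 1)) (by omega)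
    _ = _ := mul_comm _ _

theorem card_lowSets_le {n : ℕ} (hn : 1 ≤ n) (d : ℕ) : (lowSets n d).card ≤ n ^ d + 1 := by
  have h0 : (lowSets n 0).card = 1 := by
    rw [Finset.card_eq_one]
    exact ⟨∅, by ext S; simp [lowSets]⟩
  -- The induction starts at degree `1`, where the bound `n + 1` is attained: the step from degree
  -- `0` adds `n`, more than `n ^ 1 - n ^ 0`.
  match d with
  | 0 => simp [h0]
  | d + 1 =>
    induction d with
    | zero => simp [card_lowSets_succ, h0, add_comm]
    | succ d ih =>
      rw [card_lowSets_succ]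
      have h1 : n.choose (d + 1 + 1) ≤ _ := choose_succ_succ_le n d
      have h2 : n ^ (d + 1 + 1) = (n - 1) * n ^ (d + 1) + n ^ (d + 1) := by
        rw [← Nat.succ_mul, Nat.succ_eq_add_one, Nat.sub_add_cancel hn, pow_succ']
      omega

end Characters

/-! ### Expectations over the random play -/

theorem Forecast.expect_mono (Δ : Forecast) {g g' : I → ℝ} (hg : ∀ p, g p ≤ g' p) :
    Δ.expect g ≤ Δ.expect g' := by
  have h0 := Δ.τ.2.1
  have h1 := Δ.τ.2.2
  unfold Forecast.expect
  have := hg Δ.q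
  have := hg Δ.q'
  gcongr

theorem Forecast.expect_add (Δ : Forecast) (g g' : I → ℝ) :
    Δ.expect (fun p => g p + g' p) = Δ.expect g + Δ.expect g' := by
  unfold Forecast.expect; ring

theorem Forecast.expect_mul (Δ : Forecast) (c : ℝ) (g : I → ℝ) :
    Δ.expect (fun p => c * g p) = c * Δ.expect g := by
  unfold Forecast.expect; ring

theorem Forecast.expect_const (Δ : Forecast) (c : ℝ) : Δ.expect (fun _ => c) = c := by
  unfold Forecast.expect; ring

section Expectation

variable {X : Type*} (A : Forecaster X) (ν : Nature X)

theorem expectHistory_mono (t : ℕ) {g g' : History X → ℝ} (hg : ∀ h, g h ≤ g' h) :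
    expectHistory A ν t g ≤ expectHistory A ν t g' := by
  induction t generalizing g g' with
  | zero => exact hg []
  | succ t ih => exact ih fun h => Forecast.expect_mono _ fun p => hg _

theorem expectHistory_add (t : ℕ) (g g' : History X → ℝ) :
    expectHistory A ν t (fun h => g h + g' h) = expectHistory A ν t g + expectHistory A ν t g' := by
  induction t generalizing g g' with
  | zero => rfl
  | succ t ih => simp only [expectHistory, Forecast.expect_add, ih]

theorem expectHistory_mul (t : ℕ) (c : ℝ) (g : History X → ℝ) :
    expectHistory A ν t (fun h => c * g h) = c * expectHistory A ν t g := by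
  induction t generalizing g with
  | zero => rfl
  | succ t ih => simp only [expectHistory, Forecast.expect_mul, ih]

theorem expectHistory_const (t : ℕ) (c : ℝ) : expectHistory A ν t (fun _ => c) = c := by
  induction t with
  | zero => rfl
  | succ t ih => simp only [expectHistory, Forecast.expect_const, ih]

/-- Jensen for the square, from `E (g - a)² ≥ 0` with `a = E g`. -/
theorem sq_expectHistory_le (t : ℕ) (g : History X → ℝ) :
    expectHistory A ν t g ^ 2 ≤ expectHistory A ν t fun h => g h ^ 2 := by
  set a := expectHistory A ν t g with ha
  have h := expectHistory_mono A ν t (g := fun _ => 0)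
    (g' := fun h => g h ^ 2 + ((-2 * a) * g h + a ^ 2)) fun h => by nlinarith [sq_nonneg (g h - a)]
  rw [expectHistory_const, expectHistory_add, expectHistory_add, expectHistory_mul,
    expectHistory_const, ← ha] at h
  linarith

theorem sum_expectRound (T : ℕ) (φ : X → I → Bool → ℝ) :
    ∑ t ∈ Finset.range T, expectRound A ν t φ =
      expectHistory A ν T fun h => (h.map fun r => φ r.x r.p r.y).sum := by
  induction T with
  | zero => simp [expectHistory]
  | succ T ih =>
    rw [Finset.sum_range_succ, ih]
    simp only [expectHistory, List.map_cons, List.sum_cons, Forecast.expect_add,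
      Forecast.expect_const, expectHistory_add, expectRound]
    ring

end Expectation

/-! ### One step of the algorithm -/

section Step

variable {X : Type*} {k : X × I → X × I → ℝ}

theorem le_maxDiag_self (h : History X) (x : X) (p : I) : k (x, p) (x, p) ≤ maxDiag k h x p := by
  unfold maxDiag
  induction h with
  | nil => simp
  | cons r h ih => exact ih.trans (le_max_right _ _)

theorem le_maxDiag_of_mem {h : History X} {r : Round X} (hr : r ∈ h) (x : X) (p : I) :
    k (r.x, r.p) (r.x, r.p) ≤ maxDiag k h x p := by
  unfold maxDiag
  induction h with
  | nil => simp at hr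
  | cons s h ih =>
    rcases List.mem_cons.1 hr with rfl | hr
    · exact le_max_left _ _
    · exact (ih hr).trans (le_max_right _ _)

theorem maxDiag_le {C : ℝ} (hC : ∀ z, k z z ≤ C) (h : History X) (x : X) (p : I) :
    maxDiag k h x p ≤ C := by
  unfold maxDiag
  induction h with
  | nil => exact hC _
  | cons r h ih => exact max_le (hC _) ih

theorem abs_list_sum_map_le {α : Type*} (l : List α) (g : α → ℝ) {B : ℝ} (hg : ∀ a ∈ l, |g a| ≤ B) :
    |(l.map g).sum| ≤ l.length * B := by
  induction l with
  | nil => simp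
  | cons a l ih =>
    have h1 := hg a (by simp)
    have h2 := ih fun b hb => hg b (by simp [hb])
    simp only [List.map_cons, List.sum_cons, List.length_cons]
    push_cast
    linarith [abs_add_le (g a) (l.map g).sum]

theorem abs_outcomeVal_sub_le (y : Bool) (p : I) : |outcomeVal y - (p : ℝ)| ≤ 1 := by
  have h0 := p.2.1
  have h1 := p.2.2
  rw [abs_le]
  cases y <;> simp [outcomeVal] <;> constructor <;> linarith

/-- Kernels whose values are controlled by the diagonal, which is at least `1`. -/
structure DiagDominated (k : X × I → X × I → ℝ) : Prop where
  one_le : ∀ z, 1 ≤ k z z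
  abs_le : ∀ z z', |k z z'| ≤ max (k z z) (k z' z')

theorem DiagDominated.one_le_maxDiag (hk : DiagDominated k) (h : History X) (x : X) (p : I) :
    1 ≤ maxDiag k h x p :=
  (hk.one_le _).trans (le_maxDiag_self h x p)

/-- There are `t - 1` past terms with residuals at most `1` in absolute value, and one diagonal
term; each is at most `B_t`. -/
theorem DiagDominated.abs_score_le (hk : DiagDominated k) (h : History X) (x : X) (p : I) :
    |score k h x p| ≤ ((h.length : ℝ) + 1) * maxDiag k h x p := by
  have hB := hk.one_le_maxDiag h x p
  have h1 : |(h.map fun r => k (x, p) (r.x, r.p) * (outcomeVal r.y - (r.p : ℝ))).sum| ≤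
      h.length * maxDiag k h x p := by
    refine abs_list_sum_map_le _ _ fun r hr => ?_
    rw [abs_mul]
    have h2 : |k (x, p) (r.x, r.p)| ≤ maxDiag k h x p :=
      (hk.abs_le _ _).trans (max_le (le_maxDiag_self h x p) (le_maxDiag_of_mem hr x p))
    nlinarith [abs_outcomeVal_sub_le r.y r.p, abs_nonneg (k (x, p) (r.x, r.p))]
  have h3 : |1 / 2 * k (x, p) (x, p) * (1 - 2 * (p : ℝ))| ≤ maxDiag k h x p := by
    have h0 := p.2.1
    have h1 := p.2.2
    have := hk.one_le (x, p)
    have := le_maxDiag_self (k := k) h x p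
    rw [_root_.abs_le]
    constructor <;> nlinarith
  unfold score
  refine (abs_add_le _ _).trans ?_
  linarith

theorem DiagDominated.tolerance_nonneg (hk : DiagDominated k) (h : History X) (x : X) (p : I) :
    0 ≤ tolerance k h x p := by
  have hB := hk.one_le_maxDiag h x p
  unfold tolerance
  positivity

theorem DiagDominated.tolerance_le (hk : DiagDominated k) (h : History X) (x : X) (p : I) :
    tolerance k h x p ≤ 1 / 10 := by
  have hB := hk.one_le_maxDiag h x p
  unfold tolerance
  have h1 : (1 : ℝ) ≤ ((h.length : ℝ) + 1) ^ 3 := one_le_pow₀ (by linarith [h.length.cast_nonneg (α := ℝ)])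
  gcongr
  nlinarith

/-- The product is at most `t B_t / (10 t³ B_t) = 1 / (10 t²)`; the crude bound `1/10` suffices. -/
theorem DiagDominated.abs_score_mul_tolerance_le (hk : DiagDominated k) (h : History X) (x : X)
    (p : I) : |score k h x p| * tolerance k h x p ≤ 1 / 10 := by
  have hB := hk.one_le_maxDiag h x p
  have hl : (1 : ℝ) ≤ (h.length : ℝ) + 1 := by linarith [h.length.cast_nonneg (α := ℝ)]
  have hs := hk.abs_score_le h x p
  unfold tolerance
  rw [mul_one_div, div_le_div_iff₀ (by positivity) (by norm_num)]
  have h2 : (h.length : ℝ) + 1 ≤ ((h.length : ℝ) + 1) ^ 3 := le_self_pow₀ hl (by norm_num)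
  nlinarith [mul_le_mul_of_nonneg_right h2 (by linarith : 0 ≤ maxDiag k h x p)]

theorem Forecast.expect_pointMass (p : I) (g : I → ℝ) : (pointMass p).expect g = g p := by
  simp [expect, pointMass]

/-- This is the defensive property of the forecast: it holds whichever outcome is revealed
afterwards. At an endpoint forecast, `(y - p) S(p) ≤ 0` by the choice of endpoint; at a near-zero of
the score, the product is at most the tolerance; for a mixture, the mean score is zero and only the
gap between the two points contributes. -/
theorem DiagDominated.expect_score_le (hk : DiagDominated k) {h : History X} {x : X} {Δ : Forecast}
    (hΔ : IsOutput k h x Δ) (y : Bool) :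
    Δ.expect (fun p => (outcomeVal y - (p : ℝ)) * score k h x p) ≤ 1 / 10 := by
  obtain ⟨hsame, hcont, hmix⟩ := hΔ
  by_cases hS : SameSign (score k h x)
  · rcases lt_or_gt_of_ne (sign_ne_zero.1 hS.2) with h0 | h0
    · rw [(hsame hS).2 h0, Forecast.expect_pointMass]
      cases y <;> (simp [outcomeVal]; try linarith)
    · rw [(hsame hS).1 h0, Forecast.expect_pointMass]
      have h1 : 0 < score k h x 1 := by
        rw [← sign_eq_one_iff, ← hS.1, sign_eq_one_iff]; exact h0
      cases y <;> (simp [outcomeVal]; try linarith)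
  by_cases hc : ForecastContinuous k
  · obtain ⟨p, rfl, hp⟩ := hcont hS hc
    rw [Forecast.expect_pointMass]
    refine (le_abs_self _).trans ?_
    rw [abs_mul]
    nlinarith [abs_outcomeVal_sub_le y p, abs_nonneg (score k h x p), hk.tolerance_le h x p]
  · obtain ⟨hd, hq, hq', hτ⟩ := hmix hS hc
    set a := score k h x Δ.q
    set b := score k h x Δ.q'
    have h0 := Δ.τ.2.1
    have h1 := Δ.τ.2.2
    have habs : (Δ.τ : ℝ) * |a| = (1 - Δ.τ) * |b| := by linarith
    -- The weights balance the absolute values, so the mean score vanishes unless `a` and `b` share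
    -- a strict sign; that would give `S` the same nonzero sign at both ends.
    have hsum : (Δ.τ : ℝ) * a + (1 - Δ.τ) * b = 0 := by
      rcases lt_trichotomy a 0 with ha | ha | ha <;> rcases lt_trichotomy b 0 with hb | hb | hb
      · exfalso
        apply hS
        have e0 := hq.resolve_right ha.ne
        have e1 := hq'.resolve_right hb.ne
        rw [sign_neg ha] at e0
        rw [sign_neg hb] at e1
        rw [SameSign, ← e0, ← e1]
        simp
      · rw [hb] at habs ⊢
        rw [abs_of_neg ha, abs_zero] at habs
        linarith
      · rw [abs_of_neg ha, abs_of_pos hb] at habs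
        linarith
      · rw [ha] at habs ⊢
        rw [abs_of_neg hb, abs_zero] at habs
        linarith
      · simp [ha, hb]
      · rw [ha] at habs ⊢
        rw [abs_of_pos hb, abs_zero] at habs
        linarith
      · rw [abs_of_pos ha, abs_of_neg hb] at habs
        linarith
      · rw [hb] at habs ⊢
        rw [abs_of_pos ha, abs_zero] at habs
        linarith
      · exfalso
        apply hS
        have e0 := hq.resolve_right ha.ne'
        have e1 := hq'.resolve_right hb.ne'
        rw [sign_pos ha] at e0
        rw [sign_pos hb] at e1
        rw [SameSign, ← e0, ← e1]
        simp
    -- Subtracting `(y - q')` times the zero mean score removes the outcome altogether.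
    have hexp : Δ.expect (fun p => (outcomeVal y - (p : ℝ)) * score k h x p) =
        Δ.τ * (a * ((Δ.q' : ℝ) - Δ.q)) := by
      unfold Forecast.expect
      linear_combination (outcomeVal y - (Δ.q' : ℝ)) * hsum
    rw [hexp]
    have h2 : |a| * |(Δ.q' : ℝ) - Δ.q| ≤ 1 / 10 :=
      (mul_le_mul_of_nonneg_left (hd.trans (min_le_left _ _)) (abs_nonneg a)).trans
        (hk.abs_score_mul_tolerance_le h x Δ.q)
    rw [← abs_mul] at h2
    nlinarith [le_abs_self (a * ((Δ.q' : ℝ) - Δ.q)), abs_nonneg (a * ((Δ.q' : ℝ) - Δ.q))]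

end Step

/-! ### The regret bound for a kernel with a feature map -/

section Regret

variable {X H : Type*} [NormedAddCommGroup H] [InnerProductSpace ℝ H]
  {k : X × I → X × I → ℝ} {Φ : X × I → H}

/-- The sum of the features of the completed rounds, weighted by the residuals. -/
def residual (Φ : X × I → H) (h : History X) : H :=
  (h.map fun r => (outcomeVal r.y - (r.p : ℝ)) • Φ (r.x, r.p)).sum

theorem inner_residual (h : History X) (v : H) :
    inner ℝ v (residual Φ h) =
      (h.map fun r => (outcomeVal r.y - (r.p : ℝ)) * inner ℝ v (Φ (r.x, r.p))).sum := by
  unfold residual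
  induction h with
  | nil => simp
  | cons r h ih =>
    simp only [List.map_cons, List.sum_cons, inner_add_right, ih, real_inner_smul_right]

theorem norm_sq_residual_cons (hΦ : ∀ z z', inner ℝ (Φ z) (Φ z') = k z z') (h : History X)
    (x : X) (p : I) (y : Bool) :
    ‖residual Φ (⟨x, p, y⟩ :: h)‖ ^ 2 = ‖residual Φ h‖ ^ 2 +
      (2 * ((outcomeVal y - (p : ℝ)) * score k h x p) + k (x, p) (x, p) * (p * (1 - p))) := by
  have hc : residual Φ (⟨x, p, y⟩ :: h) = (outcomeVal y - (p : ℝ)) • Φ (x, p) + residual Φ h := by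
    simp [residual]
  have hs : score k h x p = inner ℝ (Φ (x, p)) (residual Φ h)
      + 1 / 2 * k (x, p) (x, p) * (1 - 2 * (p : ℝ)) := by
    simp only [score, inner_residual, hΦ, mul_comm]
  rw [hc, norm_add_sq_real, norm_smul, mul_pow, ← real_inner_self_eq_norm_sq (Φ (x, p)), hΦ, hs,
    real_inner_smul_left, Real.norm_eq_abs, sq_abs]
  -- Binary outcomes enter here: `(y - p)² = p(1 - p) + (y - p)(1 - 2p)` requires `y² = y`.
  cases y <;> simp [outcomeVal] <;> ring

/-- In the increment, twice the score term costs `2 · 1/10`, and `p(1 - p) ≤ 1/4` gives `C / 4`. -/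
theorem expectHistory_norm_sq_residual_le (hΦ : ∀ z z', inner ℝ (Φ z) (Φ z') = k z z')
    (hk : DiagDominated k) {C : ℝ} (hC : ∀ z, k z z ≤ C) {A : Forecaster X}
    (hA : IsAnyKernelAlgorithm k A) (ν : Nature X) (T : ℕ) :
    expectHistory A ν T (fun h => ‖residual Φ h‖ ^ 2) ≤ (C / 4 + 1 / 5) * T := by
  induction T with
  | zero => simp [expectHistory, residual]
  | succ T ih =>
    have hstep : ∀ h : History X, (forecastAt A ν h).expect (fun p =>
        ‖residual Φ (⟨ν.features h, p, outcomeAt A ν h⟩ :: h)‖ ^ 2) ≤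
          ‖residual Φ h‖ ^ 2 + (C / 4 + 1 / 5) := by
      intro h
      simp only [norm_sq_residual_cons hΦ, Forecast.expect_add, Forecast.expect_const,
        Forecast.expect_mul]
      have h1 := hk.expect_score_le (hA h (ν.features h)) (outcomeAt A ν h)
      have h2 : (forecastAt A ν h).expect (fun p =>
          k (ν.features h, p) (ν.features h, p) * (p * (1 - p))) ≤ C / 4 := by
        refine (Forecast.expect_mono _ fun p => ?_).trans (Forecast.expect_const _ (C / 4)).le
        have := hk.one_le (ν.features h, p)
        have := hC (ν.features h, p)
        nlinarith [sq_nonneg ((p : ℝ) - 1 / 2), mul_nonneg p.2.1 (sub_nonneg.2 p.2.2)]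
      have h3 : (forecastAt A ν h).expect (fun p => (outcomeVal (outcomeAt A ν h) - (p : ℝ)) *
        score k h (ν.features h) p) ≤ 1 / 10 := h1
      linarith
    calc _ ≤ expectHistory A ν T fun h => ‖residual Φ h‖ ^ 2 + (C / 4 + 1 / 5) :=
          expectHistory_mono A ν T hstep
      _ ≤ _ := by
        rw [expectHistory_add, expectHistory_const]
        push_cast
        linarith

theorem sq_sum_expectRound_le (hΦ : ∀ z z', inner ℝ (Φ z) (Φ z') = k z z')
    (hk : DiagDominated k) {C : ℝ} (hC : ∀ z, k z z ≤ C) {A : Forecaster X}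
    (hA : IsAnyKernelAlgorithm k A) (ν : Nature X) (T : ℕ) (w : H) :
    (∑ t ∈ Finset.range T, expectRound A ν t
      (fun x p y => inner ℝ w (Φ (x, p)) * (outcomeVal y - (p : ℝ)))) ^ 2
      ≤ ‖w‖ ^ 2 * ((C / 4 + 1 / 5) * T) := by
  rw [sum_expectRound]
  have h1 : ∀ h : History X, (h.map fun r => inner ℝ w (Φ (r.x, r.p)) *
      (outcomeVal r.y - (r.p : ℝ))).sum = inner ℝ w (residual Φ h) := fun h => by
    simp only [inner_residual, mul_comm]
  simp only [h1]
  refine (sq_expectHistory_le A ν T _).trans ?_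
  refine (expectHistory_mono A ν T (g' := fun h => ‖w‖ ^ 2 * ‖residual Φ h‖ ^ 2) fun h => ?_).trans ?_
  · rw [← mul_pow]
    exact sq_le_sq' (by linarith [neg_abs_le (inner ℝ w (residual Φ h)), abs_real_inner_le_norm w (residual Φ h)])
      (real_inner_le_norm _ _)
  · rw [expectHistory_mul]
    exact mul_le_mul_of_nonneg_left (expectHistory_norm_sq_residual_le hΦ hk hC hA ν T)
      (sq_nonneg _)

end Regret

/-! ### Existence of outputs -/

section Existence

variable {X : Type*} {k : X × I → X × I → ℝ}

theorem ForecastContinuous.continuous_score (hk : ForecastContinuous k) (h : History X) (x : X) :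
    Continuous (score k h x) := by
  have h1 : ∀ x', Continuous fun p : I => k (x, p) (x', p) := fun x' =>
    (hk x x').comp (continuous_id.prodMk continuous_id)
  have h2 : ∀ x' p', Continuous fun p : I => k (x, p) (x', p') := fun x' p' =>
    (hk x x').comp (continuous_id.prodMk continuous_const)
  unfold score
  refine Continuous.add ?_ ?_
  · exact continuous_list_sum h fun r _ => (h2 r.x r.p).mul continuous_const
  · exact (continuous_const.mul (h1 x)).mul (by fun_prop)

/-- No continuity is needed: on a grid of mesh below `δ`, the first point whose sign differs from
that at `0` and its predecessor form the pair. -/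
theorem exists_adjacent {S : I → ℝ} (h : SignType.sign (S 0) ≠ SignType.sign (S 1)) {δ : ℝ}
    (hδ : 0 < δ) : ∃ q q' : I, |(q' : ℝ) - q| ≤ δ ∧ SignType.sign (S q) = SignType.sign (S 0) ∧
      SignType.sign (S q') ≠ SignType.sign (S 0) := by
  classical
  obtain ⟨m, hm⟩ := exists_nat_one_div_lt hδ
  set g : ℕ → I := fun j => Set.projIcc 0 1 zero_le_one ((j : ℝ) / (m + 1)) with hg
  have hex : ∃ j, SignType.sign (S (g j)) ≠ SignType.sign (S 0) := by
    refine ⟨m + 1, ?_⟩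
    have : g (m + 1) = 1 := by
      simp only [hg]
      push_cast
      rw [div_self (by positivity)]
      exact Set.projIcc_right zero_le_one
    rw [this]
    exact h.symm
  have h0 : Nat.find hex ≠ 0 := by
    intro h0
    have := Nat.find_spec hex
    rw [h0] at this
    apply this
    have : g 0 = 0 := by
      simp only [hg, Nat.cast_zero, zero_div]
      exact Set.projIcc_left zero_le_one
    rw [this]
  obtain ⟨j, hj⟩ := Nat.exists_eq_succ_of_ne_zero h0
  refine ⟨g j, g (j + 1), ?_, ?_, ?_⟩
  · have h1 := abs_max_sub_max_le_max 0 (min 1 (((j + 1 : ℕ) : ℝ) / (m + 1))) 0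
      (min 1 ((j : ℝ) / (m + 1)))
    have h2 := abs_min_sub_min_le_max 1 (((j + 1 : ℕ) : ℝ) / (m + 1)) 1 ((j : ℝ) / (m + 1))
    have h3 : |((j + 1 : ℕ) : ℝ) / (m + 1) - (j : ℝ) / (m + 1)| ≤ δ := by
      rw [← sub_div]
      push_cast
      rw [add_sub_cancel_left, abs_of_pos (by positivity)]
      exact hm.le
    simp only [hg, Set.coe_projIcc]
    refine h1.trans (max_le (by simpa using hδ.le) (h2.trans (max_le (by simpa using hδ.le) h3)))
  · by_contra hc
    have := Nat.find_min' hex hc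
    omega
  · have := Nat.find_spec hex
    rwa [hj] at this

/-- A continuous score without a common nonzero endpoint sign has an exact zero by the intermediate
value theorem; otherwise a sufficiently fine grid search succeeds, or an endpoint that is a zero
serves as both points. -/
theorem DiagDominated.exists_isOutput (hk : DiagDominated k) {C : ℝ} (hC : ∀ z, k z z ≤ C)
    (h : History X) (x : X) : ∃ Δ, IsOutput k h x Δ := by
  set S := score k h x with hSdef
  have htol : ∀ p, 0 ≤ tolerance k h x p := hk.tolerance_nonneg h x
  by_cases hS : SameSign S
  · rcases lt_or_gt_of_ne (sign_ne_zero.1 hS.2) with h0 | h0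
    · exact ⟨.pointMass 0, fun _ => ⟨fun h1 => absurd h1 h0.not_gt, fun _ => rfl⟩,
        fun h1 => absurd hS h1, fun h1 => absurd hS h1⟩
    · exact ⟨.pointMass 1, fun _ => ⟨fun _ => rfl, fun h1 => absurd h1 h0.not_gt⟩,
        fun h1 => absurd hS h1, fun h1 => absurd hS h1⟩
  by_cases hc : ForecastContinuous k
  · obtain ⟨p, hp⟩ : ∃ p, S p = 0 := by
      have hcont := hc.continuous_score h x
      rcases le_total (S 0) 0 with h0 | h0
      · rcases le_total 0 (S 1) with h1 | h1
        · exact mem_range_of_exists_le_of_exists_ge hcont ⟨0, h0⟩ ⟨1, h1⟩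
        · rcases h0.eq_or_lt with h0 | h0
          · exact ⟨0, h0⟩
          rcases h1.eq_or_lt with h1 | h1
          · exact ⟨1, h1⟩
          exact absurd ⟨by rw [sign_neg h0, sign_neg h1], by simp [sign_neg h0]⟩ hS
      · rcases le_total 0 (S 1) with h1 | h1
        · rcases h0.eq_or_lt with h0 | h0
          · exact ⟨0, h0.symm⟩
          rcases h1.eq_or_lt with h1 | h1
          · exact ⟨1, h1.symm⟩
          exact absurd ⟨by rw [sign_pos h0, sign_pos h1], by simp [sign_pos h0]⟩ hS
        · exact mem_range_of_exists_le_of_exists_ge hcont ⟨1, h1⟩ ⟨0, h0⟩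
    exact ⟨.pointMass p, fun h1 => absurd h1 hS,
      fun _ _ => ⟨p, rfl, by rw [← hSdef, hp, abs_zero]; exact htol p⟩, fun _ h1 => absurd hc h1⟩
  · suffices hmix : ∃ q q' : I, |(q' : ℝ) - q| ≤ min (tolerance k h x q) (tolerance k h x q') ∧
        (SignType.sign (S q) = SignType.sign (S 0) ∨ S q = 0) ∧
        (SignType.sign (S q') = SignType.sign (S 1) ∨ S q' = 0) by
      obtain ⟨q, q', hd, hq, hq'⟩ := hmix
      have hle : |S q'| ≤ |S q| + |S q'| := by linarith [abs_nonneg (S q)]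
      refine ⟨⟨q, q', ⟨|S q'| / (|S q| + |S q'|), by positivity,
        div_le_one_of_le₀ hle (by positivity)⟩⟩, fun h1 => absurd h1 hS, fun _ h1 => absurd h1 hc,
        fun _ _ => ⟨hd, hq, hq', ?_⟩⟩
      -- If the denominator is zero, so is `|S q'|`, and the value `0` of the quotient is
      -- admissible.
      refine div_mul_cancel_of_imp fun h1 => le_antisymm (hle.trans h1.le) (abs_nonneg _)
    have htriv : ∀ q : I, |(q : ℝ) - q| ≤ min (tolerance k h x q) (tolerance k h x q) := fun q => by
      simpa using htol q
    by_cases h0 : S 0 = 0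
    · exact ⟨0, 0, htriv 0, Or.inr h0, Or.inr h0⟩
    have hne : SignType.sign (S 0) ≠ SignType.sign (S 1) := fun h1 => hS ⟨h1, sign_ne_zero.2 h0⟩
    have hC0 : 1 ≤ C := (hk.one_le (x, 0)).trans (hC _)
    -- The tolerance depends on the point still to be found; the uniform bound `C` on the diagonal
    -- gives a mesh valid for every candidate.
    have hδ : ∀ p, 1 / (10 * ((h.length : ℝ) + 1) ^ 3 * C) ≤ tolerance k h x p := fun p => by
      have := hk.one_le_maxDiag h x p
      unfold tolerance
      gcongr
      exact maxDiag_le hC h x p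
    obtain ⟨q, q', hd, hq, hq'⟩ := exists_adjacent hne
      (δ := 1 / (10 * ((h.length : ℝ) + 1) ^ 3 * C)) (by positivity)
    by_cases h1 : S 1 = 0
    · exact ⟨1, 1, htriv 1, Or.inr h1, Or.inr h1⟩
    refine ⟨q, q', hd.trans (le_min (hδ q) (hδ q')), Or.inl hq, ?_⟩
    rw [← sign_eq_zero_iff (a := S q')]
    rw [← ne_eq, ← sign_ne_zero] at h0 h1
    -- The end signs are nonzero and distinct, so a sign different from that at `0` is that at `1`
    -- or zero: a finite check on three signs.
    revert hne hq' h0 h1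
    generalize SignType.sign (S 0) = a
    generalize SignType.sign (S 1) = b
    generalize SignType.sign (S q') = c
    revert a b c
    decide

end Existence

/-! ### The product kernel -/

section Product

variable {n d N : ℕ}

/-- The feature space of the sum of the Sobolev kernel and the grid kernel. -/
abbrev ForecastSpace (N : ℕ) : Type :=
  WithLp 2 (SobolevSpace × EuclideanSpace ℝ (Finset.Icc 1 N))

/-- The feature map of the sum of the Sobolev kernel and the grid kernel. -/
def forecastFeature (N : ℕ) (p : I) : ForecastSpace N :=
  WithLp.toLp 2 (sobolevFeature p, gridFeature N p)

theorem inner_forecastFeature (p p' : I) :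
    inner ℝ (forecastFeature N p) (forecastFeature N p') =
      sobolevKernel p p' + gridKernel N p p' := by
  rw [WithLp.prod_inner_apply, ← inner_sobolevFeature, ← inner_gridFeature]
  rfl

theorem exists_inner_forecastFeature {f : I → ℝ} (hf : f ∈ ctsFun ∪ gridFun N) :
    ∃ w : ForecastSpace N, ‖w‖ ^ 2 ≤ 2 ∧ ∀ p, inner ℝ w (forecastFeature N p) = f p := by
  rcases hf with hf | hf
  · obtain ⟨w, hw, hwf⟩ := exists_inner_sobolevFeature hf
    refine ⟨WithLp.toLp 2 (w, 0), ?_, fun p => ?_⟩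
    · rw [WithLp.prod_norm_sq_eq_of_L2]
      simpa using hw
    · rw [WithLp.prod_inner_apply, ← hwf]
      simp [forecastFeature]
  · obtain ⟨w, hw, hwf⟩ := exists_inner_gridFeature hf
    refine ⟨WithLp.toLp 2 (0, w), ?_, fun p => ?_⟩
    · rw [WithLp.prod_norm_sq_eq_of_L2]
      simpa using hw
    · rw [WithLp.prod_inner_apply, ← hwf]
      simp [forecastFeature]

/-- The feature space of the product kernel. -/
abbrev ProductSpace (n d N : ℕ) : Type := PiLp 2 fun _ : lowSets n d => ForecastSpace N

/-- The feature map of the product kernel. -/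
def productFeature (n d N : ℕ) (z : Cube n × I) : ProductSpace n d N :=
  WithLp.toLp 2 fun S => chi S.1 z.1 • forecastFeature N z.2

/-- The tensor product of the two feature spaces is realised as a direct sum of copies of
`ForecastSpace N`, one for each low-degree character; this turns products of kernels into inner
products. -/
theorem inner_productFeature (z z' : Cube n × I) :
    inner ℝ (productFeature n d N z) (productFeature n d N z') = productKernel n d N z z' := by
  rw [PiLp.inner_apply, productKernel, lowDegKernel, Finset.mul_sum, ← Finset.sum_coe_sort (lowSets n d)]
  refine Finset.sum_congr rfl fun S _ => ?_
  simp only [productFeature, real_inner_smul_left, real_inner_smul_right, inner_forecastFeature]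
  ring

/-- The representer is the tensor `α ⊗ u`, of squared norm `(∑ α_S²) ‖u‖² ≤ 1 · 2`. -/
theorem exists_inner_productFeature {fx : Cube n → ℝ} (hfx : fx ∈ lowDeg n d) {fp : I → ℝ}
    (hfp : fp ∈ ctsFun ∪ gridFun N) : ∃ w : ProductSpace n d N, ‖w‖ ^ 2 ≤ 2 ∧
      ∀ z, inner ℝ w (productFeature n d N z) = fx z.1 * fp z.2 := by
  obtain ⟨hbd, α, -, hα⟩ := hfx
  obtain ⟨u, hu, huf⟩ := exists_inner_forecastFeature hfp
  refine ⟨WithLp.toLp 2 fun S => α S.1 • u, ?_, fun z => ?_⟩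
  · rw [PiLp.norm_sq_eq_of_L2]
    simp only [norm_smul, mul_pow, Real.norm_eq_abs, sq_abs]
    rw [Finset.sum_coe_sort (lowSets n d) fun S => α S ^ 2 * ‖u‖ ^ 2, ← Finset.sum_mul]
    have h1 := sum_sq_coeff_le_one hbd hα
    nlinarith [sq_nonneg ‖u‖]
  · rw [PiLp.inner_apply, hα, Finset.sum_mul, ← Finset.sum_coe_sort (lowSets n d)]
    refine Finset.sum_congr rfl fun S _ => ?_
    simp only [productFeature, real_inner_smul_left, real_inner_smul_right, huf]
    ring

theorem productKernel_self (hN : 1 ≤ N) (z : Cube n × I) :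
    productKernel n d N z z = (sobolevKernel z.2 z.2 + 1) * (lowSets n d).card := by
  rw [productKernel, gridKernel_self hN, lowDegKernel_self]

theorem productKernel_self_le (hN : 1 ≤ N) (z : Cube n × I) :
    productKernel n d N z z ≤ 3 * (lowSets n d).card := by
  rw [productKernel_self hN]
  gcongr
  linarith [sobolevKernel_self_le z.2]

/-- The grid part alone contributes `1` on the diagonal. Off the diagonal, Cauchy–Schwarz applies,
and a product of two norms is at most the larger square. -/
theorem diagDominated_productKernel (hN : 1 ≤ N) : DiagDominated (productKernel n d N) where
  one_le z := by
    rw [productKernel_self hN]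
    have h1 : (1 : ℝ) ≤ (lowSets n d).card := by exact_mod_cast one_le_card_lowSets n d
    nlinarith [sobolevKernel_nonneg z.2 z.2]
  abs_le z z' := by
    simp only [← inner_productFeature, real_inner_self_eq_norm_sq]
    refine (abs_real_inner_le_norm _ _).trans ?_
    rw [le_max_iff]
    rcases le_total ‖productFeature n d N z‖ ‖productFeature n d N z'‖ with h | h
    · exact Or.inr (by nlinarith [norm_nonneg (productFeature n d N z')])
    · exact Or.inl (by nlinarith [norm_nonneg (productFeature n d N z)])

end Product

end AnyKernel
end

/-! ### The calibration bound for the product kernel -/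

theorem corollary3p1 (n d N : ℕ) (hn : 1 ≤ n) (hN : 1 ≤ N) :
    (∀ (h : AnyKernel.History (AnyKernel.Cube n)) (x : AnyKernel.Cube n),
      ∃ Δ : AnyKernel.Forecast, AnyKernel.IsOutput (AnyKernel.productKernel n d N) h x Δ) ∧
    ∀ A : AnyKernel.Forecaster (AnyKernel.Cube n),
      AnyKernel.IsAnyKernelAlgorithm (AnyKernel.productKernel n d N) A →
      ∀ (ν : AnyKernel.Nature (AnyKernel.Cube n)) (T : ℕ),
      ∀ fx ∈ AnyKernel.lowDeg n d, ∀ fp ∈ AnyKernel.ctsFun ∪ AnyKernel.gridFun N,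
        |∑ t ∈ Finset.range T, AnyKernel.expectRound A ν t
            (fun x p y => fx x * fp p * (AnyKernel.outcomeVal y - (p : ℝ)))|
          ≤ 6 * Real.sqrt ((n : ℝ) ^ d * T) := by
  have hk := AnyKernel.diagDominated_productKernel (n := n) (d := d) hN
  have hC := AnyKernel.productKernel_self_le (n := n) (d := d) hN
  refine ⟨hk.exists_isOutput hC, fun A hA ν T fx hfx fp hfp => ?_⟩
  obtain ⟨w, hw, hwf⟩ := AnyKernel.exists_inner_productFeature hfx hfp
  have hreg := AnyKernel.sq_sum_expectRound_le AnyKernel.inner_productFeature hk hC hA ν T w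
  simp only [hwf] at hreg
  refine abs_le_of_sq_le_sq (hreg.trans ?_) (by positivity)
  rw [mul_pow, Real.sq_sqrt (by positivity)]
  have hcard : ((AnyKernel.lowSets n d).card : ℝ) ≤ (n : ℝ) ^ d + 1 := by
    exact_mod_cast AnyKernel.card_lowSets_le hn d
  have hpow : (1 : ℝ) ≤ (n : ℝ) ^ d := one_le_pow₀ (by exact_mod_cast hn)
  have hT : (0 : ℝ) ≤ T := T.cast_nonneg
  -- As `n ^ d ≥ 1`, the bracket is at most `3(n^d + 1)/4 + 1/5 ≤ 2 n^d`; the total `4 n^d T` is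
  -- well below the required `36 n^d T`.
  calc ‖w‖ ^ 2 * ((3 * ((AnyKernel.lowSets n d).card : ℝ) / 4 + 1 / 5) * T)
      ≤ 2 * ((2 * (n : ℝ) ^ d) * T) := by
        gcongr
        linarith
    _ ≤ 6 ^ 2 * ((n : ℝ) ^ d * T) := by nlinarith [mul_nonneg (by linarith : 0 ≤ (n : ℝ) ^ d) hT]
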